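/- A \emph{game} is a pair $\mathbb X=(X,\to)$ of a set $X$ and a relation ${\to}\subset X\times X$ such that every $x\in X$ has only finitely many $x'$ with $x\to x'$, and there is no infinite path $x_0\to x_1\to x_2\to\cdots$. A \emph{game morphism} $(X,\to_{\mathbb X})\to(Y,\to_{\mathbb Y})$ is a function $f\colon X\to Y$ such that $x\to_{\mathbb X}x'$ implies $f(x)\to_{\mathbb Y}f(x')$, and such that whenever $f(x)\to_{\mathbb Y}y$ there is $x'\in X$ with $x\to_{\mathbb X}x'$ and $f(x')=y$. Let $\mathbf{Game}$ be the category of games and game morphisms and $U\colon\mathbf{Game}\to\mathbf{Set}$, $(X,\to)\mapsto X$, the forgetful functor. A \emph{non-unital monoidal structure} on a category $\mathcal C$ is a functor $\ast\colon\mathcal C\times\mathcal C\to\mathcal C$ with a natural isomorphism $(A\ast B)\ast C\cong A\ast(B\ast C)$ satisfying the pentagon identity; it is \emph{symmetric} when equipped with a natural self-inverse braiding $A\ast B\cong B\ast A$ satisfying the hexagon identity. A (unital or non-unital) monoidal structure is \emph{closed} if for every object $A$ the functor $A\ast{-}\colon\mathcal C\to\mathcal C$ has a right adjoint. \textbf{Corollary.}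 Let $\ast$ be a unital or non-unital monoidal structure on $\mathbf{Game}$ that lifts the cartesian product of sets along $U$, i.e. such that the square of functors $$U\circ{\ast}\;\cong\;{\times}\circ(U\times U)\colon\ \mathbf{Game}\times\mathbf{Game}\to\mathbf{Set}$$ commutes (strictly or, more generally, up to a natural isomorphism). Then $\ast$ is closed. In particular, the following three operations on games, each having underlying set $X\times Y$, acting on morphisms by $(f,g)\mapsto f\times g$, and having as structural isomorphisms the evident bijections of underlying sets, are symmetric monoidal closed structures on $\mathbf{Game}$: \begin{itemize} \item the Conway addition $\mathbb X+\mathbb Y$, where $(x,y)\to(x',y')$ iff ($x\to x'$ and $y=y'$) or ($x=x'$ and $y\to y'$), with unit the game with one state and no moves; \item the selective sum $\mathbb X\vee\mathbb Y$, where $(x,y)\to(x',y')$ iff ($x\to x'$ and $y=y'$) or ($x\to x'$ and $y\to y'$) or ($x=x'$ and $y\to y'$), with the same unit; \item the conjunctive sum $\mathbb X\wedge\mathbb Y$, where $(x,y)\to(x',y')$ iff $x\to x'$ and $y\to y'$, as a non-unital symmetric monoidal structure. \end{itemize} -/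

import Mathlib

open CategoryTheory MonoidalCategory
open scoped Prod

universe v u

/-! ## Games -/

/-- An (impartial) game: a set of states with a move relation such that every state has
finitely many options and there is no infinite path. -/
structure Game : Type (u + 1) where
  /-- The underlying set of states. -/
  State : Type u
  /-- `Move x x'` is the relation `x → x'`. -/
  Move : State → State → Prop
  finite_options : ∀ x, {x' | Move x x'}.Finite
  finite_time : ¬ ∃ p : ℕ → State, ∀ n, Move (p n) (p (n + 1))

namespace Game

/-- A game morphism: a graph morphism with the path-lifting property. -/
@[ext]
structure Hom (X Y : Game.{u}) where
  toFun : X.State → Y.State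
  map_move : ∀ {x x'}, X.Move x x' → Y.Move (toFun x) (toFun x')
  lift_move : ∀ {x y}, Y.Move (toFun x) y → ∃ x', X.Move x x' ∧ toFun x' = y

/-- The category of games and game morphisms. -/
instance : Category Game.{u} where
  Hom := Hom
  id X := ⟨fun x => x, fun h => h, fun h => ⟨_, h, rfl⟩⟩
  comp f g :=
    { toFun := fun x => g.toFun (f.toFun x)
      map_move := fun h => g.map_move (f.map_move h)
      lift_move := fun h => by
        obtain ⟨y, hy, rfl⟩ := g.lift_move h
        obtain ⟨x, hx, rfl⟩ := f.lift_move hy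
        exact ⟨x, hx, rfl⟩ }

@[ext]
theorem hom_ext {X Y : Game.{u}} {f g : X ⟶ Y} (h : ∀ x, Hom.toFun f x = Hom.toFun g x) :
    f = g :=
  Hom.ext (funext h)

/-- The forgetful functor from games to sets. -/
def U : Game.{u} ⥤ Type u where
  obj X := X.State
  map f := TypeCat.ofHom (Hom.toFun f)

/-- A bijection that preserves and reflects moves is an isomorphism of games. -/
def isoOfEquiv {X Y : Game.{u}} (e : X.State ≃ Y.State)
    (h : ∀ a b, X.Move a b ↔ Y.Move (e a) (e b)) : X ≅ Y where
  hom :=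
    { toFun := e
      map_move := fun {a b} hab => (h a b).1 hab
      lift_move := fun {a y} hy => ⟨e.symm y, (h _ _).2 (by simpa using hy), by simp⟩ }
  inv :=
    { toFun := e.symm
      map_move := fun {a b} hab => (h _ _).2 (by simpa using hab)
      lift_move := fun {y a} hy => ⟨e a, by simpa using (h _ _).1 hy, by simp⟩ }
  hom_inv_id := by ext x; exact e.symm_apply_apply x
  inv_hom_id := by ext x; exact e.apply_symm_apply x

/-! ## The three sums of games, on objects and on morphisms -/

/-- The move relation of the Conway sum: move in exactly one component. -/
def ConwayMove (X Y : Game.{u}) (p q : X.State × Y.State) : Prop :=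
  (X.Move p.1 q.1 ∧ p.2 = q.2) ∨ (p.1 = q.1 ∧ Y.Move p.2 q.2)

/-- The move relation of the selective sum: move in at least one component. -/
def SelectiveMove (X Y : Game.{u}) (p q : X.State × Y.State) : Prop :=
  (X.Move p.1 q.1 ∧ p.2 = q.2) ∨ (X.Move p.1 q.1 ∧ Y.Move p.2 q.2) ∨
    (p.1 = q.1 ∧ Y.Move p.2 q.2)

/-- The move relation of the conjunctive sum: move in both components. -/
def ConjunctiveMove (X Y : Game.{u}) (p q : X.State × Y.State) : Prop :=
  X.Move p.1 q.1 ∧ Y.Move p.2 q.2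

theorem ConwayMove.selective {X Y : Game.{u}} {p q : X.State × Y.State}
    (h : ConwayMove X Y p q) : SelectiveMove X Y p q := by
  unfold ConwayMove at h
  unfold SelectiveMove
  tauto

theorem ConjunctiveMove.selective {X Y : Game.{u}} {p q : X.State × Y.State}
    (h : ConjunctiveMove X Y p q) : SelectiveMove X Y p q :=
  Or.inr (Or.inl h)

theorem wellFounded_move (X : Game.{u}) : WellFounded fun a b => X.Move b a := by
  rw [wellFounded_iff_isEmpty_descending_chain]
  exact ⟨fun p => X.finite_time ⟨p.1, p.2⟩⟩

theorem selective_finite_options (X Y : Game.{u}) (p : X.State × Y.State) :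
    {q | SelectiveMove X Y p q}.Finite := by
  refine (((X.finite_options p.1).insert p.1).prod
    ((Y.finite_options p.2).insert p.2)).subset ?_
  rintro q (⟨h, h'⟩ | ⟨h, h'⟩ | ⟨h, h'⟩)
  · exact ⟨Or.inr h, Or.inl h'.symm⟩
  · exact ⟨Or.inr h, Or.inr h'⟩
  · exact ⟨Or.inl h.symm, Or.inr h'⟩

theorem selective_finite_time (X Y : Game.{u}) :
    ¬ ∃ p : ℕ → X.State × Y.State, ∀ n, SelectiveMove X Y (p n) (p (n + 1)) := by
  rintro ⟨p, hp⟩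
  have wf := WellFounded.prod_lex X.wellFounded_move Y.wellFounded_move
  rw [wellFounded_iff_isEmpty_descending_chain] at wf
  refine wf.false ⟨p, fun n => ?_⟩
  rw [Prod.lex_def]
  rcases hp n with h | h | h
  · exact Or.inl h.1
  · exact Or.inl h.1
  · exact Or.inr ⟨h.1.symm, h.2⟩

/-- The Conway sum `X + Y`. -/
def conway (X Y : Game.{u}) : Game.{u} where
  State := X.State × Y.State
  Move := ConwayMove X Y
  finite_options p := (selective_finite_options X Y p).subset fun _ h => h.selective
  finite_time := fun ⟨p, hp⟩ => selective_finite_time X Y ⟨p, fun n => (hp n).selective⟩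

/-- The selective sum `X ∨ Y`. -/
def selective (X Y : Game.{u}) : Game.{u} where
  State := X.State × Y.State
  Move := SelectiveMove X Y
  finite_options := selective_finite_options X Y
  finite_time := selective_finite_time X Y

/-- The conjunctive sum `X ∧ Y`. -/
def conjunctive (X Y : Game.{u}) : Game.{u} where
  State := X.State × Y.State
  Move := ConjunctiveMove X Y
  finite_options p := (selective_finite_options X Y p).subset fun _ h => h.selective
  finite_time := fun ⟨p, hp⟩ => selective_finite_time X Y ⟨p, fun n => (hp n).selective⟩

/-- The game with one state and no moves. -/
def one : Game.{u} where
  State := PUnit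
  Move _ _ := False
  finite_options _ := by simp
  finite_time := fun ⟨_, hp⟩ => hp 0

/-- The Conway sum of two game morphisms. -/
def conwayMap {X X' Y Y' : Game.{u}} (f : X ⟶ X') (g : Y ⟶ Y') :
    conway X Y ⟶ conway X' Y' :=
  Hom.mk (X := conway X Y) (Y := conway X' Y')
    (Prod.map (Hom.toFun f) (Hom.toFun g))
    (by
      rintro ⟨x, y⟩ ⟨x', y'⟩ (⟨h, h'⟩ | ⟨h, h'⟩)
      · exact Or.inl ⟨Hom.map_move f h, congrArg (Hom.toFun g) h'⟩
      · exact Or.inr ⟨congrArg (Hom.toFun f) h, Hom.map_move g h'⟩)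
    (by
      rintro ⟨x, y⟩ ⟨a, b⟩ (⟨h, h'⟩ | ⟨h, h'⟩)
      · obtain ⟨x', hx, rfl⟩ := Hom.lift_move f h
        exact ⟨(x', y), Or.inl ⟨hx, rfl⟩, Prod.ext rfl h'⟩
      · obtain ⟨y', hy, rfl⟩ := Hom.lift_move g h'
        exact ⟨(x, y'), Or.inr ⟨rfl, hy⟩, Prod.ext h rfl⟩)

/-- The selective sum of two game morphisms. -/
def selectiveMap {X X' Y Y' : Game.{u}} (f : X ⟶ X') (g : Y ⟶ Y') :
    selective X Y ⟶ selective X' Y' :=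
  Hom.mk (X := selective X Y) (Y := selective X' Y')
    (Prod.map (Hom.toFun f) (Hom.toFun g))
    (by
      rintro ⟨x, y⟩ ⟨x', y'⟩ (⟨h, h'⟩ | ⟨h, h'⟩ | ⟨h, h'⟩)
      · exact Or.inl ⟨Hom.map_move f h, congrArg (Hom.toFun g) h'⟩
      · exact Or.inr (Or.inl ⟨Hom.map_move f h, Hom.map_move g h'⟩)
      · exact Or.inr (Or.inr ⟨congrArg (Hom.toFun f) h, Hom.map_move g h'⟩))
    (by
      rintro ⟨x, y⟩ ⟨a, b⟩ (⟨h, h'⟩ | ⟨h, h'⟩ | ⟨h, h'⟩)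
      · obtain ⟨x', hx, rfl⟩ := Hom.lift_move f h
        exact ⟨(x', y), Or.inl ⟨hx, rfl⟩, Prod.ext rfl h'⟩
      · obtain ⟨x', hx, rfl⟩ := Hom.lift_move f h
        obtain ⟨y', hy, rfl⟩ := Hom.lift_move g h'
        exact ⟨(x', y'), Or.inr (Or.inl ⟨hx, hy⟩), rfl⟩
      · obtain ⟨y', hy, rfl⟩ := Hom.lift_move g h'
        exact ⟨(x, y'), Or.inr (Or.inr ⟨rfl, hy⟩), Prod.ext h rfl⟩)

/-- The conjunctive sum of two game morphisms. -/
def conjunctiveMap {X X' Y Y' : Game.{u}} (f : X ⟶ X') (g : Y ⟶ Y') :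
    conjunctive X Y ⟶ conjunctive X' Y' :=
  Hom.mk (X := conjunctive X Y) (Y := conjunctive X' Y')
    (Prod.map (Hom.toFun f) (Hom.toFun g))
    (fun h => ⟨Hom.map_move f h.1, Hom.map_move g h.2⟩)
    (by
      rintro ⟨x, y⟩ ⟨a, b⟩ ⟨h, h'⟩
      obtain ⟨x', hx, rfl⟩ := Hom.lift_move f h
      obtain ⟨y', hy, rfl⟩ := Hom.lift_move g h'
      exact ⟨(x', y'), ⟨hx, hy⟩, rfl⟩)

end Game

/-! ## Monoidal structures, unital or not -/

/-- A non-unital monoidal structure on a category: a tensor bifunctor with a natural associativity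
isomorphism satisfying the pentagon identity. -/
structure NonUnitalMonoidalStructure (C : Type u) [Category.{v} C] where
  tensor : C × C ⥤ C
  associator : ∀ X Y Z : C,
    tensor.obj (tensor.obj (X, Y), Z) ≅ tensor.obj (X, tensor.obj (Y, Z))
  associator_naturality : ∀ {X X' Y Y' Z Z' : C} (f : X ⟶ X') (g : Y ⟶ Y') (h : Z ⟶ Z'),
    tensor.map (tensor.map (f ×ₘ g) ×ₘ h) ≫ (associator X' Y' Z').hom =
      (associator X Y Z).hom ≫ tensor.map (f ×ₘ tensor.map (g ×ₘ h))
  pentagon : ∀ W X Y Z : C,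
    tensor.map ((associator W X Y).hom ×ₘ 𝟙 Z) ≫
        (associator W (tensor.obj (X, Y)) Z).hom ≫
          tensor.map (𝟙 W ×ₘ (associator X Y Z).hom) =
      (associator (tensor.obj (W, X)) Y Z).hom ≫ (associator W X (tensor.obj (Y, Z))).hom

/-- A non-unital monoidal structure is closed if `X ∗ -` has a right adjoint for every `X`. -/
def NonUnitalMonoidalStructure.IsMonoidalClosed {C : Type u} [Category.{v} C]
    (T : NonUnitalMonoidalStructure C) : Prop :=
  ∀ X : C, (Prod.sectR X C ⋙ T.tensor).IsLeftAdjoint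

/-- A non-unital symmetric monoidal structure. -/
structure NonUnitalSymmetricMonoidalStructure (C : Type u) [Category.{v} C] extends
    NonUnitalMonoidalStructure C where
  braiding : ∀ X Y : C, tensor.obj (X, Y) ≅ tensor.obj (Y, X)
  braiding_naturality : ∀ {X X' Y Y' : C} (f : X ⟶ X') (g : Y ⟶ Y'),
    tensor.map (f ×ₘ g) ≫ (braiding X' Y').hom = (braiding X Y).hom ≫ tensor.map (g ×ₘ f)
  symmetry : ∀ X Y : C, (braiding X Y).hom ≫ (braiding Y X).hom = 𝟙 (tensor.obj (X, Y))
  hexagon : ∀ X Y Z : C,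
    (associator X Y Z).hom ≫ (braiding X (tensor.obj (Y, Z))).hom ≫ (associator Y Z X).hom =
      tensor.map ((braiding X Y).hom ×ₘ 𝟙 Z) ≫ (associator Y X Z).hom ≫
        tensor.map (𝟙 Y ×ₘ (braiding X Z).hom)

/-- A (unital) symmetric monoidal structure, as a bundled object. -/
structure SymmetricMonoidalStructure (C : Type u) [Category.{v} C] where
  monoidal : MonoidalCategory C
  symmetric : SymmetricCategory C

/-- The underlying monoidal category is closed. -/
def SymmetricMonoidalStructure.IsMonoidalClosed {C : Type u} [Category.{v} C]
    (S : SymmetricMonoidalStructure C) : Prop :=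
  letI := S.monoidal
  Nonempty (MonoidalClosed C)

namespace Game

/-- The bifunctor `F` on games lifts the cartesian product of sets along the forgetful functor:
the square formed by `F`, `U × U`, `U` and `×` commutes. Commutation is required only up to a
natural isomorphism `U (X ∗ Y) ≅ U X × U Y`, so that strict commutation is a special case. -/
def LiftsCartesian (F : Game.{u} × Game.{u} ⥤ Game.{u}) : Prop :=
  Nonempty (F ⋙ U ≅ U.prod U ⋙ MonoidalCategory.tensor (Type u))

/-! ## The three sums as symmetric monoidal structures -/

/-- The Conway addition, with unit the game with one state and no moves; the structural
isomorphisms are the evident bijections of underlying sets. -/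
abbrev conwayMonoidal : MonoidalCategory Game.{u} where
  tensorObj := conway
  whiskerLeft X _ _ f := conwayMap (𝟙 X) f
  whiskerRight f Y := conwayMap f (𝟙 Y)
  tensorHom := conwayMap
  tensorUnit := one
  associator X Y Z := isoOfEquiv (X := conway (conway X Y) Z) (Y := conway X (conway Y Z))
    (Equiv.prodAssoc _ _ _) (by
      rintro ⟨⟨x, y⟩, z⟩ ⟨⟨x', y'⟩, z'⟩
      change _ ↔ ConwayMove X (conway Y Z) (x, (y, z)) (x', (y', z'))
      simp only [conway, ConwayMove, Prod.mk.injEq]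
      tauto)
  leftUnitor X := isoOfEquiv (X := conway one X) (Y := X) (Equiv.punitProd _) (by
      rintro ⟨⟨⟩, x⟩ ⟨⟨⟩, x'⟩
      change ConwayMove one X _ _ ↔ X.Move x x'
      simp [ConwayMove, one])
  rightUnitor X := isoOfEquiv (X := conway X one) (Y := X) (Equiv.prodPUnit _) (by
      rintro ⟨x, ⟨⟩⟩ ⟨x', ⟨⟩⟩
      change ConwayMove X one _ _ ↔ X.Move x x'
      simp [ConwayMove, one])
  tensorHom_def _ _ := rfl
  id_tensorHom_id _ _ := rfl
  tensorHom_comp_tensorHom _ _ _ _ := rfl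
  whiskerLeft_id _ _ := rfl
  id_whiskerRight _ _ := rfl
  associator_naturality _ _ _ := rfl
  leftUnitor_naturality _ := rfl
  rightUnitor_naturality _ := rfl
  pentagon _ _ _ _ := rfl
  triangle _ _ := rfl

/-- The Conway addition as a symmetric monoidal structure. -/
def conwayAddition : SymmetricMonoidalStructure Game.{u} where
  monoidal := conwayMonoidal
  symmetric :=
    letI := conwayMonoidal.{u}
    { braiding := fun X Y => isoOfEquiv (X := conway X Y) (Y := conway Y X)
        (Equiv.prodComm _ _) (by
          rintro ⟨x, y⟩ ⟨x', y'⟩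
          change ConwayMove X Y (x, y) (x', y') ↔ ConwayMove Y X (y, x) (y', x')
          simp only [ConwayMove]
          tauto)
      braiding_naturality_right := fun _ _ _ _ => rfl
      braiding_naturality_left := fun _ _ => rfl
      hexagon_forward := fun _ _ _ => rfl
      hexagon_reverse := fun _ _ _ => rfl
      symmetry := fun _ _ => rfl }

/-- The selective sum, with unit the game with one state and no moves; the structural
isomorphisms are the evident bijections of underlying sets. -/
abbrev selectiveMonoidal : MonoidalCategory Game.{u} where
  tensorObj := selective
  whiskerLeft X _ _ f := selectiveMap (𝟙 X) f
  whiskerRight f Y := selectiveMap f (𝟙 Y)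
  tensorHom := selectiveMap
  tensorUnit := one
  associator X Y Z := isoOfEquiv (X := selective (selective X Y) Z)
    (Y := selective X (selective Y Z)) (Equiv.prodAssoc _ _ _) (by
      rintro ⟨⟨x, y⟩, z⟩ ⟨⟨x', y'⟩, z'⟩
      change _ ↔ SelectiveMove X (selective Y Z) (x, (y, z)) (x', (y', z'))
      simp only [selective, SelectiveMove, Prod.mk.injEq]
      tauto)
  leftUnitor X := isoOfEquiv (X := selective one X) (Y := X) (Equiv.punitProd _) (by
      rintro ⟨⟨⟩, x⟩ ⟨⟨⟩, x'⟩
      change SelectiveMove one X _ _ ↔ X.Move x x'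
      simp [SelectiveMove, one])
  rightUnitor X := isoOfEquiv (X := selective X one) (Y := X) (Equiv.prodPUnit _) (by
      rintro ⟨x, ⟨⟩⟩ ⟨x', ⟨⟩⟩
      change SelectiveMove X one _ _ ↔ X.Move x x'
      simp [SelectiveMove, one])
  tensorHom_def _ _ := rfl
  id_tensorHom_id _ _ := rfl
  tensorHom_comp_tensorHom _ _ _ _ := rfl
  whiskerLeft_id _ _ := rfl
  id_whiskerRight _ _ := rfl
  associator_naturality _ _ _ := rfl
  leftUnitor_naturality _ := rfl
  rightUnitor_naturality _ := rfl
  pentagon _ _ _ _ := rfl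
  triangle _ _ := rfl

/-- The selective sum as a symmetric monoidal structure. -/
def selectiveSum : SymmetricMonoidalStructure Game.{u} where
  monoidal := selectiveMonoidal
  symmetric :=
    letI := selectiveMonoidal.{u}
    { braiding := fun X Y => isoOfEquiv (X := selective X Y) (Y := selective Y X)
        (Equiv.prodComm _ _) (by
          rintro ⟨x, y⟩ ⟨x', y'⟩
          change SelectiveMove X Y (x, y) (x', y') ↔ SelectiveMove Y X (y, x) (y', x')
          simp only [SelectiveMove]
          tauto)
      braiding_naturality_right := fun _ _ _ _ => rfl
      braiding_naturality_left := fun _ _ => rfl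
      hexagon_forward := fun _ _ _ => rfl
      hexagon_reverse := fun _ _ _ => rfl
      symmetry := fun _ _ => rfl }

/-- The conjunctive sum as a non-unital symmetric monoidal structure. -/
def conjunctiveSum : NonUnitalSymmetricMonoidalStructure Game.{u} where
  tensor :=
    { obj := fun P => conjunctive P.1 P.2
      map := fun f => conjunctiveMap f.1 f.2
      map_id := fun _ => rfl
      map_comp := fun _ _ => rfl }
  associator X Y Z := isoOfEquiv (X := conjunctive (conjunctive X Y) Z)
    (Y := conjunctive X (conjunctive Y Z)) (Equiv.prodAssoc _ _ _) (by
      rintro ⟨⟨x, y⟩, z⟩ ⟨⟨x', y'⟩, z'⟩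
      change _ ↔ ConjunctiveMove X (conjunctive Y Z) (x, (y, z)) (x', (y', z'))
      simp only [conjunctive, ConjunctiveMove]
      tauto)
  associator_naturality _ _ _ := rfl
  pentagon _ _ _ _ := rfl
  braiding X Y := isoOfEquiv (X := conjunctive X Y) (Y := conjunctive Y X)
    (Equiv.prodComm _ _) (by
      rintro ⟨x, y⟩ ⟨x', y'⟩
      change ConjunctiveMove X Y (x, y) (x', y') ↔ ConjunctiveMove Y X (y, x) (y', x')
      simp only [ConjunctiveMove]
      tauto)
  braiding_naturality _ _ := rfl
  symmetry _ _ := rfl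
  hexagon _ _ _ := rfl

end Game

/-!
The theorem is an application of the special adjoint functor theorem to the functors `X ∗ -`.

A game is a well-founded coalgebra for the finite powerset functor, and game morphisms are the
coalgebra morphisms. As for any category of coalgebras, the forgetful functor `U` creates colimits:
on a colimit of the underlying sets, the options of the class of `x` are the classes of the options
of `x`, which is independent of the representative because morphisms both preserve and lift moves
(`Game.colimitMove_ι_iff`); well-foundedness survives because an infinite path lifts along a colimit
injection. So games are cocomplete and `U` preserves and reflects colimits. If `∗` lifts the
cartesian product, then `U (X ∗ -) ≅ U X × U -` preserves colimits, `Type u` being cartesian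
closed, and hence `X ∗ -` preserves them too.

The remaining hypotheses of the adjoint functor theorem hold for the following reasons. An
epimorphism of games is surjective, and a surjective morphism is determined up to isomorphism by
its kernel, so the category is well-copowered. By well-founded induction, only finitely many states
are reachable from a given state, so the games on the sets `Fin n` separate morphisms
(`Game.isSeparating_finiteGames`).
-/

open Limits

namespace Game

/-! ### Maps out of a jointly surjective family -/

/-- A function of states is a game morphism as soon as its restrictions along a jointly surjective
family of game morphisms are. -/
def homOfJointlySurjective {ι : Type*} {X : ι → Game.{u}} {A B : Game.{u}} (e : ∀ i, X i ⟶ A)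
    (he : ∀ a, ∃ i x, Hom.toFun (e i) x = a) (k : ∀ i, X i ⟶ B) (φ : A.State → B.State)
    (h : ∀ i x, φ (Hom.toFun (e i) x) = Hom.toFun (k i) x) : A ⟶ B :=
  Hom.mk φ
    (by
      intro a a' haa'
      obtain ⟨i, x, rfl⟩ := he a
      obtain ⟨x', hx, rfl⟩ := Hom.lift_move (e i) haa'
      rw [h, h]
      exact Hom.map_move (k i) hx)
    (by
      intro a b hab
      obtain ⟨i, x, rfl⟩ := he a
      rw [h] at hab
      obtain ⟨x', hx, rfl⟩ := Hom.lift_move (k i) hab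
      exact ⟨_, Hom.map_move (e i) hx, h i x'⟩)

/-! ### Colimits of games -/

section Colimit

variable {J : Type u} [Category.{u} J] (D : J ⥤ Game.{u}) (c : Cocone (D ⋙ U))

/-- The images of the moves of the games `D j` under a cocone on their sets of states. -/
def ColimitMove (a b : c.pt) : Prop :=
  ∃ j, ∃ x x' : (D.obj j).State, (D.obj j).Move x x' ∧ c.ι.app j x = a ∧ c.ι.app j x' = b

variable {D c}

theorem cocone_w_apply {i j : J} (f : i ⟶ j) (x : (D.obj i).State) :
    c.ι.app j (Hom.toFun (D.map f) x) = c.ι.app i x :=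
  ConcreteCategory.congr_hom (c.w f) x

/-- The options of the class of `x` are the classes of the options of `x`. This holds because the
set of classes of options of `x` is compatible with the transition maps of the diagram, and so
descends to the colimit. -/
theorem colimitMove_ι_iff (hc : IsColimit c) {j : J} (x : (D.obj j).State) (b : c.pt) :
    ColimitMove D c (c.ι.app j x) b ↔ ∃ x', (D.obj j).Move x x' ∧ c.ι.app j x' = b := by
  let s : Cocone (D ⋙ U) :=
    { pt := Set c.pt
      ι :=
        { app := fun j => TypeCat.ofHom fun x : (D.obj j).State =>
            ({b | ∃ x', (D.obj j).Move x x' ∧ c.ι.app j x' = b} : Set c.pt)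
          naturality := by
            intro i j f
            ext x
            change {b | ∃ x', (D.obj j).Move (Hom.toFun (D.map f) x) x' ∧ c.ι.app j x' = b} =
              {b | ∃ x', (D.obj i).Move x x' ∧ c.ι.app i x' = b}
            ext b
            constructor
            · rintro ⟨y, hy, rfl⟩
              obtain ⟨x', hx, rfl⟩ := Hom.lift_move (D.map f) hy
              exact ⟨x', hx, (cocone_w_apply f x').symm⟩
            · rintro ⟨x', hx, rfl⟩
              exact ⟨_, Hom.map_move (D.map f) hx, cocone_w_apply f x'⟩ } }
  have key : ∀ (i : J) (y : (D.obj i).State), (hc.desc s (c.ι.app i y) : Set c.pt) =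
      {b | ∃ x', (D.obj i).Move y x' ∧ c.ι.app i x' = b} :=
    fun i y => ConcreteCategory.congr_hom (hc.fac s i) y
  constructor
  · rintro ⟨i, y, y', hy, hyx, rfl⟩
    have h : c.ι.app i y' ∈ (hc.desc s (c.ι.app i y) : Set c.pt) := by
      rw [key]; exact ⟨y', hy, rfl⟩
    rwa [hyx, key] at h
  · rintro ⟨x', hx, rfl⟩
    exact ⟨j, x, x', hx, rfl, rfl⟩

theorem exists_ι_eq (hc : IsColimit c) (a : c.pt) :
    ∃ (j : J) (x : (D.obj j).State), c.ι.app j x = a :=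
  Types.jointly_surjective_of_isColimit hc a

/-- The colimit of a diagram of games, on a given colimit of the sets of states. -/
def colimitGame (hc : IsColimit c) : Game.{u} where
  State := c.pt
  Move := ColimitMove D c
  finite_options a := by
    obtain ⟨j, x, rfl⟩ := exists_ι_eq hc a
    refine (((D.obj j).finite_options x).image (c.ι.app j)).subset fun b hb => ?_
    exact (colimitMove_ι_iff hc x b).1 hb
  finite_time := by
    rintro ⟨p, hp⟩
    obtain ⟨j, x, hx⟩ := exists_ι_eq hc (p 0)
    -- Lift the path step by step to the game `D j` that contains a representative of its start.
    choose! next hnext using fun (y : (D.obj j).State) (b : c.pt) =>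
      (colimitMove_ι_iff hc y b).1
    let q : ℕ → (D.obj j).State := fun n => Nat.rec x (fun n y => next y (p (n + 1))) n
    have hq : ∀ n, c.ι.app j (q n) = p n := by
      intro n
      induction n with
      | zero => exact hx
      | succ n ih => exact (hnext (q n) (p (n + 1)) (ih ▸ hp n)).2
    exact (D.obj j).finite_time
      ⟨q, fun n => (hnext (q n) (p (n + 1)) ((hq n).symm ▸ hp n)).1⟩

/-- The colimit cocone of games over a given colimit cocone of sets of states. -/
def colimitGameCocone (hc : IsColimit c) : Cocone D where
  pt := colimitGame hc
  ι :=
    { app := fun j => Hom.mk (X := D.obj j) (Y := colimitGame hc) (fun x => c.ι.app j x)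
        (fun {x x'} h => ⟨j, x, x', h, rfl, rfl⟩)
        (fun {x b} h => (colimitMove_ι_iff hc x b).1 h)
      naturality := by
        intro i j f
        apply hom_ext
        intro x
        exact cocone_w_apply f x }

end Colimit

/-- A cocone of games is a colimit if its cocone of sets of states is. -/
def isColimitOfIsColimitMapCocone {J : Type u} [Category.{u} J] {D : J ⥤ Game.{u}} {c : Cocone D}
    (hc : IsColimit (U.mapCocone c)) : IsColimit c :=
  have fac (s : Cocone D) (j : J) (x : (D.obj j).State) :
      hc.desc (U.mapCocone s) (Hom.toFun (c.ι.app j) x) = Hom.toFun (s.ι.app j) x :=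
    ConcreteCategory.congr_hom (hc.fac (U.mapCocone s) j) x
  { desc := fun s => homOfJointlySurjective c.ι.app (exists_ι_eq hc) s.ι.app
      (fun a => hc.desc (U.mapCocone s) a) (fac s)
    fac := fun s j => hom_ext (fac s j)
    uniq := fun s m hm => by
      apply hom_ext
      intro a
      obtain ⟨j, x, rfl⟩ := exists_ι_eq hc a
      refine Eq.trans ?_ (fac s j x).symm
      exact congrArg (fun k => Hom.toFun k x) (hm j) }

instance : ReflectsColimits U.{u} where
  reflectsColimitsOfShape :=
    { reflectsColimit := { reflects := fun hc => ⟨isColimitOfIsColimitMapCocone hc⟩ } }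

/-- The cocone of games constructed from a colimit of sets is a colimit. -/
def isColimitColimitGameCocone {J : Type u} [Category.{u} J] {D : J ⥤ Game.{u}}
    {c : Cocone (D ⋙ U)} (hc : IsColimit c) : IsColimit (colimitGameCocone hc) :=
  isColimitOfIsColimitMapCocone (show IsColimit (U.mapCocone (colimitGameCocone hc)) from hc)

instance : HasColimits Game.{u} where
  has_colimits_of_shape _ _ :=
    { has_colimit := fun D => ⟨_, isColimitColimitGameCocone (colimit.isColimit (D ⋙ U))⟩ }

instance : PreservesColimits U.{u} where
  preservesColimitsOfShape :=
    { preservesColimit := fun {D} =>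
        preservesColimit_of_preserves_colimit_cocone
          (isColimitColimitGameCocone (colimit.isColimit (D ⋙ U)))
          (show IsColimit (U.mapCocone (colimitGameCocone _)) from colimit.isColimit (D ⋙ U)) }

/-! ### Quotients of games -/

theorem surjective_of_epi {X Y : Game.{u}} (f : X ⟶ Y) [Epi f] :
    Function.Surjective (Hom.toFun f) :=
  (ofHom_epi_iff_surjective _).1 (inferInstanceAs (Epi (U.map f)))

/-- A morphism factors through an epimorphism whose kernel is contained in its own. -/
theorem exists_factorization {X A B : Game.{u}} (e : X ⟶ A) [Epi e] (k : X ⟶ B)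
    (h : ∀ x y, Hom.toFun e x = Hom.toFun e y → Hom.toFun k x = Hom.toFun k y) :
    ∃ g : A ⟶ B, e ≫ g = k := by
  have he := surjective_of_epi e
  have hφ : ∀ x, Hom.toFun k (Function.surjInv he (Hom.toFun e x)) = Hom.toFun k x :=
    fun x => h _ _ (Function.surjInv_eq he _)
  exact ⟨homOfJointlySurjective (fun _ : Unit => e) (fun a => ⟨(), he a⟩) (fun _ => k)
    (fun a => Hom.toFun k (Function.surjInv he a)) (fun _ => hφ), hom_ext hφ⟩

/-- Games are well-copowered: a quotient of `X` is determined by its kernel. -/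
instance : WellPowered.{u} Game.{u}ᵒᵖ where
  subobject_small X := by
    let ker (S : Subobject X) : Set (X.unop.State × X.unop.State) :=
      {p | Hom.toFun S.arrow.unop p.1 = Hom.toFun S.arrow.unop p.2}
    have le_of_ker {S T : Subobject X} (h : ker T ⊆ ker S) : S ≤ T := by
      obtain ⟨g, hg⟩ := exists_factorization T.arrow.unop S.arrow.unop
        (fun x y hxy => h (show (x, y) ∈ ker T from hxy))
      exact Subobject.le_of_comm g.op (Quiver.Hom.unop_inj hg)
    exact small_of_injective (f := ker) fun S T h =>
      le_antisymm (le_of_ker h.ge) (le_of_ker h.le)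

/-! ### A small separating family -/

/-- The states reachable from `x` by finitely many moves. -/
def reachable (X : Game.{u}) (x : X.State) : Set X.State :=
  {y | Relation.ReflTransGen X.Move x y}

theorem finite_reachable (X : Game.{u}) (x : X.State) : (X.reachable x).Finite := by
  induction x using X.wellFounded_move.induction with
  | _ x ih =>
    refine (((X.finite_options x).biUnion ih).insert x).subset fun y hy => ?_
    rcases Relation.ReflTransGen.cases_head hy with rfl | ⟨x', hx, hy⟩
    · exact Set.mem_insert _ _
    · exact Set.mem_insert_of_mem _ (Set.mem_biUnion hx hy)

/-- The game on a set `S` obtained by restricting the moves of `X` along an injection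
`i : S → X.State`. -/
def comap (X : Game.{u}) {S : Type u} (i : S → X.State) (hi : Function.Injective i) :
    Game.{u} where
  State := S
  Move a b := X.Move (i a) (i b)
  finite_options a := (X.finite_options (i a)).preimage hi.injOn
  finite_time := fun ⟨p, hp⟩ => X.finite_time ⟨fun n => i (p n), hp⟩

/-- The inclusion of a set of states that is closed under moves is a game morphism. -/
def comapHom (X : Game.{u}) {S : Type u} (i : S → X.State) (hi : Function.Injective i)
    (h : ∀ a y, X.Move (i a) y → ∃ b, i b = y) : X.comap i hi ⟶ X :=
  Hom.mk (X := X.comap i hi) i (fun h => h) (by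
    intro a y hy
    obtain ⟨b, rfl⟩ := h a y hy
    exact ⟨b, hy, rfl⟩)

/-- Move relations on the set `Fin n` that make it into a game. -/
def FiniteGameRel (n : ℕ) : Type u :=
  {r : ULift.{u} (Fin n) → ULift.{u} (Fin n) → Prop // ¬ ∃ p : ℕ → _, ∀ n, r (p n) (p (n + 1))}

/-- The games whose set of states is (a lift of) `Fin n` for some `n`. -/
def finiteGames : ObjectProperty Game.{u} :=
  .ofObj fun r : Σ n : ℕ, FiniteGameRel.{u} n =>
    { State := ULift.{u} (Fin r.1)
      Move := r.2.1
      finite_options := fun _ => Set.toFinite _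
      finite_time := r.2.2 }

instance : ObjectProperty.Small.{u} finiteGames.{u} :=
  inferInstanceAs (ObjectProperty.Small.{u} (.ofObj _))

theorem isSeparating_finiteGames : finiteGames.{u}.IsSeparating := by
  intro X Y f g h
  apply hom_ext
  intro x
  -- It suffices to test on the finite subgame of states reachable from `x`.
  have : Finite (X.reachable x) := X.finite_reachable x
  obtain ⟨n, ⟨e⟩⟩ := Finite.exists_equiv_fin (X.reachable x)
  let i : ULift.{u} (Fin n) → X.State := fun k => e.symm k.down
  have hi : Function.Injective i :=
    Subtype.val_injective.comp (e.symm.injective.comp ULift.down_injective)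
  have hr : ∀ y ∈ X.reachable x, ∃ k, i k = y := fun y hy => ⟨⟨e ⟨y, hy⟩⟩, by simp [i]⟩
  have hcl : ∀ a y, X.Move (i a) y → ∃ b, i b = y := fun a y hy =>
    hr y (Relation.ReflTransGen.tail (e.symm a.down).2 hy)
  obtain ⟨k, hk⟩ := hr x Relation.ReflTransGen.refl
  have hG : finiteGames (X.comap i hi) :=
    ObjectProperty.ofObj_apply _
      (⟨n, (X.comap i hi).Move, (X.comap i hi).finite_time⟩ : Σ n : ℕ, FiniteGameRel.{u} n)
  have hfg := congrArg (fun m => Hom.toFun m k) (h _ hG (X.comapHom i hi hcl))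
  change Hom.toFun f (i k) = Hom.toFun g (i k) at hfg
  rwa [hk] at hfg

/-! ### Closedness of lifts of the cartesian product -/

theorem isLeftAdjoint_of_liftsCartesian {F : Game.{u} × Game.{u} ⥤ Game.{u}}
    (hF : LiftsCartesian F) (X : Game.{u}) : (Prod.sectR X Game.{u} ⋙ F).IsLeftAdjoint := by
  obtain ⟨α⟩ := hF
  have β : U ⋙ tensorLeft (U.obj X) ≅ (Prod.sectR X Game.{u} ⋙ F) ⋙ U :=
    NatIso.ofComponents (fun Y => (α.app (X, Y)).symm) (by
      intro Y Z f
      have h := α.inv.naturality ((𝟙 X : X ⟶ X) ×ₘ f)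
      exact h)
  have : PreservesColimits ((Prod.sectR X Game.{u} ⋙ F) ⋙ U) :=
    preservesColimits_of_natIso β
  have : PreservesColimits (Prod.sectR X Game.{u} ⋙ F) :=
    preservesColimits_of_reflects_of_preserves _ U
  exact isLeftAdjoint_of_preservesColimits_of_isSeparating isSeparating_finiteGames _

theorem nonempty_monoidalClosed [MonoidalCategory Game.{u}]
    (h : LiftsCartesian (MonoidalCategory.tensor Game.{u})) :
    Nonempty (MonoidalClosed Game.{u}) := by
  have (X : Game.{u}) : (tensorLeft X).IsLeftAdjoint := by
    have := isLeftAdjoint_of_liftsCartesian h X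
    exact Functor.isLeftAdjoint_of_iso (F := Prod.sectR X Game.{u} ⋙ MonoidalCategory.tensor _)
      (NatIso.ofComponents (fun _ => Iso.refl _) fun f =>
        (Category.comp_id _).trans ((id_tensorHom X f).trans (Category.id_comp _).symm))
  exact ⟨⟨fun X => ⟨_, Adjunction.ofIsLeftAdjoint (tensorLeft X)⟩⟩⟩

end Game

/-- Every non-unital and every unital monoidal structure on the category of games that lifts the
cartesian product of sets along the forgetful functor is closed; in particular the Conway
addition, the selective sum and the (non-unital) conjunctive sum are symmetric monoidal closed. -/
theorem mainTheorem9 :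
    (∀ T : NonUnitalMonoidalStructure Game.{u},
      Game.LiftsCartesian T.tensor → T.IsMonoidalClosed) ∧
    (∀ [MonoidalCategory Game.{u}],
      Game.LiftsCartesian (MonoidalCategory.tensor Game.{u}) →
        Nonempty (MonoidalClosed Game.{u})) ∧
    Game.conwayAddition.{u}.IsMonoidalClosed ∧
    Game.selectiveSum.{u}.IsMonoidalClosed ∧
    Game.conjunctiveSum.{u}.IsMonoidalClosed := by
  refine ⟨fun T hT => Game.isLeftAdjoint_of_liftsCartesian hT, Game.nonempty_monoidalClosed,
    ?_, ?_, ?_⟩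
  · let _ := Game.conwayMonoidal.{u}
    exact Game.nonempty_monoidalClosed ⟨NatIso.ofComponents fun _ => Iso.refl _⟩
  · let _ := Game.selectiveMonoidal.{u}
    exact Game.nonempty_monoidalClosed ⟨NatIso.ofComponents fun _ => Iso.refl _⟩
  · exact Game.isLeftAdjoint_of_liftsCartesian ⟨NatIso.ofComponents fun _ => Iso.refl _⟩
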